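/- Let $\Psi_T=\frac1{\sqrt T}\sum_{i=0}^{T-1}|i\rangle|i\rangle\in\mathbb C^T\otimes\mathbb C^T$, and for a density matrix $\sigma$ on $\mathbb C^T\otimes\mathbb C^T$ let $F(\sigma)=\langle\Psi_T|\sigma|\Psi_T\rangle$ be its fidelity. A general entanglement purification protocol (GEPP) $\mathcal P$ takes a bipartite state $\rho$ on $\mathbb C^N\otimes\mathbb C^N$ shared by Alice and Bob, together with the auxiliary state $\Psi_K$; Alice and Bob then perform finitely many rounds of local quantum operations and classical communication (LOCC), with finitely many outcomes and finite-dimensional local systems, and either output the symbol FAIL or output a (possibly mixed) state $\mathcal P(\rho)$ on $\mathbb C^M\otimes\mathbb C^M$. At the end they may keep a part of the classical information produced during the protocol; $\mathcal P(\rho)$ is the mixture over everything that is not kept, so it is a random variable depending on the kept part only. Call $\mathcal P$ absolutely successful with parameter $\langle N,K,M,\epsilon,\delta\rangle$ if for every state $\rho$ with $F(\rho)\ge 1-\epsilon$ we have $\Pr[\mathcal P(\rho)=\mathrm{FAIL}]=0$ and $\Pr[F(\mathcal P(\rho))\ge 1-\delta]=1$. Let $N\ge 2$ and $K,M\ge 1$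 be integers. (a) Let $0\le\epsilon\le 1-\frac1N$ and let $\delta$ be real. If some GEPP is absolutely successful with parameter $\langle N,K,M,\epsilon,\delta\rangle$, then $$\delta\ \ge\ \frac{M-K}{M}\cdot\frac{N}{N-1}\,\epsilon .$$ (b) The bound in (a) is tight: if $NK/M$ and $M/K$ are both integers, then there is a GEPP (one and the same for all $\epsilon\ge 0$) that is absolutely successful with parameter $\left\langle N,K,M,\epsilon,\frac{M-K}{M}\cdot\frac{N}{N-1}\,\epsilon\right\rangle$. -/

import Mathlib

open scoped Matrix Kronecker BigOperators ComplexOrder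

namespace Purification

/-- Operators on the bipartite space `ℂ^a ⊗ ℂ^b`; the first factor belongs to Alice, the second one
to Bob. -/
abbrev BiOp (a b : ℕ) : Type := Matrix (Fin a × Fin b) (Fin a × Fin b) ℂ

/-- A (possibly mixed) state, given by its density matrix. -/
def IsState {a b : ℕ} (ρ : BiOp a b) : Prop :=
  ρ.PosSemidef ∧ ρ.trace = 1

/-- The maximally entangled vector `Ψ_T = T^(-1/2) ∑ i, |i⟩|i⟩` in `ℂ^T ⊗ ℂ^T`. -/
noncomputable def maxEnt (T : ℕ) : Fin T × Fin T → ℂ :=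
  fun p => if p.1 = p.2 then ((1 / Real.sqrt T : ℝ) : ℂ) else 0

/-- The projector `|Ψ_T⟩⟨Ψ_T|`. -/
noncomputable def maxEntState (T : ℕ) : BiOp T T :=
  Matrix.vecMulVec (maxEnt T) (star (maxEnt T))

/-- The fidelity `⟨Ψ_T| ρ |Ψ_T⟩` of `ρ` with the maximally entangled state. -/
noncomputable def fidelity {T : ℕ} (ρ : BiOp T T) : ℝ :=
  (star (maxEnt T) ⬝ᵥ (ρ *ᵥ maxEnt T)).re

/-- A local quantum instrument from dimension `d` to dimension `d'` with `m` classical outcomes: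
for each outcome a completely positive map (in Kraus form), these maps adding up to a trace
preserving one. It covers unitaries, (general) measurements, introducing ancillas, discarding
subsystems, classical randomness, and all combinations of these. -/
structure Instrument (d d' m : ℕ) where
  numKraus : ℕ
  kraus : Fin m → Fin numKraus → Matrix (Fin d') (Fin d) ℂ
  complete : ∑ i, ∑ k, (kraus i k)ᴴ * kraus i k = 1

/-- The unnormalised state after Alice applies `E` to her part and observes outcome `i`. -/
noncomputable def Instrument.onAlice {a a' m b : ℕ} (E : Instrument a a' m) (i : Fin m)
    (ρ : BiOp a b) : BiOp a' b :=
  ∑ k, (E.kraus i k ⊗ₖ (1 : Matrix (Fin b) (Fin b) ℂ)) * ρ *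
    (E.kraus i k ⊗ₖ (1 : Matrix (Fin b) (Fin b) ℂ))ᴴ

/-- The unnormalised state after Bob applies `E` to his part and observes outcome `i`. -/
noncomputable def Instrument.onBob {a b b' m : ℕ} (E : Instrument b b' m) (i : Fin m)
    (ρ : BiOp a b) : BiOp a b' :=
  ∑ k, ((1 : Matrix (Fin a) (Fin a) ℂ) ⊗ₖ E.kraus i k) * ρ *
    ((1 : Matrix (Fin a) (Fin a) ℂ) ⊗ₖ E.kraus i k)ᴴ

/-- LOCC protocols that start on `ℂ^a ⊗ ℂ^b` and either output `FAIL` or output a state of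
`ℂ^M ⊗ ℂ^M`. In each step one of the parties applies a local instrument and communicates its
outcome; the rest of the protocol may depend on the outcome. An output comes with a classical record
`j : Fin r`, which is all the classical information that is kept at the end: branches with the same
record are mixed. -/
inductive LOCC (M r : ℕ) : ℕ → ℕ → Type
  | fail (a b : ℕ) : LOCC M r a b
  | output (j : Fin r) : LOCC M r M M
  | alice {a b : ℕ} (a' m : ℕ) (E : Instrument a a' m) (next : Fin m → LOCC M r a' b) :
      LOCC M r a b
  | bob {a b : ℕ} (b' m : ℕ) (E : Instrument b b' m) (next : Fin m → LOCC M r a b') :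
      LOCC M r a b

namespace LOCC

variable {M r : ℕ}

/-- The probability that the protocol outputs `FAIL` on input `ρ`. -/
noncomputable def failProb : {a b : ℕ} → LOCC M r a b → BiOp a b → ℝ
  | _, _, fail _ _, ρ => ρ.trace.re
  | _, _, output _, _ => 0
  | _, _, alice _ _ E next, ρ => ∑ i, (next i).failProb (E.onAlice i ρ)
  | _, _, bob _ _ E next, ρ => ∑ i, (next i).failProb (E.onBob i ρ)

/-- The unnormalised state that the protocol outputs together with the record `j` on input `ρ`. -/
noncomputable def branch (j : Fin r) : {a b : ℕ} → LOCC M r a b → BiOp a b → BiOp M M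
  | _, _, fail _ _, _ => 0
  | _, _, output j', ρ => if j' = j then ρ else 0
  | _, _, alice _ _ E next, ρ => ∑ i, branch j (next i) (E.onAlice i ρ)
  | _, _, bob _ _ E next, ρ => ∑ i, branch j (next i) (E.onBob i ρ)

/-- The probability that the protocol outputs a state together with the record `j`. -/
noncomputable def outProb {a b : ℕ} (P : LOCC M r a b) (ρ : BiOp a b) (j : Fin r) : ℝ :=
  (P.branch j ρ).trace.re

/-- The (normalised) state that the protocol outputs, given that the record is `j`. -/
noncomputable def outState {a b : ℕ} (P : LOCC M r a b) (ρ : BiOp a b) (j : Fin r) : BiOp M M :=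
  ((P.outProb ρ j)⁻¹ : ℝ) • P.branch j ρ

end LOCC

/-- The joint state `ρ ⊗ |Ψ_K⟩⟨Ψ_K|`, Alice and Bob each holding `ℂ^N ⊗ ℂ^K = ℂ^(N * K)`. -/
noncomputable def withAux {N : ℕ} (K : ℕ) (ρ : BiOp N N) : BiOp (N * K) (N * K) :=
  (ρ ⊗ₖ maxEntState K).submatrix
    (fun p => ((p.1.divNat, p.2.divNat), (p.1.modNat, p.2.modNat)))
    (fun p => ((p.1.divNat, p.2.divNat), (p.1.modNat, p.2.modNat)))

/-- A general entanglement purification protocol: an LOCC protocol whose input is a state of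
`ℂ^N ⊗ ℂ^N` together with the auxiliary state `Ψ_K`. -/
structure GEPP (N K M : ℕ) where
  numRecords : ℕ
  locc : LOCC M numRecords (N * K) (N * K)

namespace GEPP

variable {N K M : ℕ}

/-- The probability that the protocol outputs `FAIL` on input `ρ`. -/
noncomputable def probFail (P : GEPP N K M) (ρ : BiOp N N) : ℝ :=
  P.locc.failProb (withAux K ρ)

/-- The probability that on input `ρ` the protocol outputs a state of fidelity at least `f`. -/
noncomputable def probFidelityGE (P : GEPP N K M) (ρ : BiOp N N) (f : ℝ) : ℝ :=
  ∑ j, if f ≤ fidelity (P.locc.outState (withAux K ρ) j) then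
    P.locc.outProb (withAux K ρ) j else 0

/-- `P` is absolutely successful with parameter `⟨N, K, M, ε, δ⟩`. -/
def AbsolutelySuccessful (P : GEPP N K M) (ε δ : ℝ) : Prop :=
  ∀ ρ : BiOp N N, IsState ρ → 1 - ε ≤ fidelity ρ →
    P.probFail ρ = 0 ∧ P.probFidelityGE ρ (1 - δ) = 1

end GEPP

end Purification

/-!
Write a pure bipartite state as a matrix; its rank is the Schmidt rank, which no branch of an LOCC
protocol can increase, and a vector of Schmidt rank `s` in `ℂ^M ⊗ ℂ^M` has fidelity at most `s / M`.
The state `|x⟩|x⟩ ⊗ Ψ_K` has Schmidt rank at most `K`, so on it every protocol has expected fidelity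
at most `K / M`. The expected fidelity being linear in the input, the mixture
`(1 - t) Ψ_N + t |xx⟩⟨xx|` with `t = N ε / (N - 1)`, whose fidelity is `1 - ε`, gives the bound.

For the tightness let `L = M / K`. Alice and Bob partition the `N` basis vectors at random into
parts of size `L` and measure the part; if their results agree they keep their state, otherwise they
reset it to `|x⟩|x⟩`. In both cases they keep `Ψ_K` as a tensor factor. Two different basis vectors
share a part with probability `(L - 1) / (N - 1)`, so the expected output fidelity is an explicit
affine function of the input fidelity, and it attains the bound.
-/

namespace Purification

section RankAndTrace

variable {𝕜 m n : Type*} [RCLike 𝕜] [Fintype n]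

theorem sq_norm_trace_conjTranspose_mul_le [Fintype m] (A B : Matrix m n 𝕜) :
    ‖(Aᴴ * B).trace‖ ^ 2 ≤ RCLike.re (Aᴴ * A).trace * RCLike.re (Bᴴ * B).trace := by
  have inner_vec (C D : Matrix m n 𝕜) :
      inner 𝕜 (WithLp.toLp 2 C.vec) (WithLp.toLp 2 D.vec) = (Cᴴ * D).trace := by
    rw [EuclideanSpace.inner_toLp_toLp, dotProduct_comm, Matrix.star_vec_dotProduct_vec]
  have cauchySchwarz :=
    inner_mul_inner_self_le (𝕜 := 𝕜) (WithLp.toLp 2 A.vec) (WithLp.toLp 2 B.vec)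
  rwa [norm_inner_symm (WithLp.toLp 2 B.vec), ← sq, inner_vec, inner_vec, inner_vec]
    at cauchySchwarz

theorem exists_isStarProjection_mul_eq_self (X : Matrix n n 𝕜) :
    ∃ P : Matrix n n 𝕜, IsStarProjection P ∧ P.trace = X.rank ∧ P * X = X := by
  classical
  let b := EuclideanSpace.basisFun n 𝕜
  let Φ := Matrix.toLinAlgEquiv b.toBasis
  let S := LinearMap.range (Φ X)
  let P := Φ.symm S.starProjection.toLinearMap
  have hP : Φ P = S.starProjection.toLinearMap := Φ.apply_symm_apply _
  refine ⟨P, ⟨?_, ?_⟩, ?_, ?_⟩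
  · refine IsIdempotentElem.map ?_ Φ.symm
    exact congrArg ContinuousLinearMap.toLinearMap S.isIdempotentElem_starProjection
  · refine (Matrix.isSymmetric_toLin_iff b).1 ?_
    change (Φ P).IsSymmetric
    exact hP ▸ S.starProjection_isSymmetric
  · rw [← Matrix.trace_toLin_eq P b.toBasis, X.rank_eq_finrank_range_toLin b.toBasis b.toBasis]
    change LinearMap.trace 𝕜 _ (Φ P) = Module.finrank 𝕜 S
    rw [hP]
    exact LinearMap.IsProj.trace
      ⟨S.starProjection_apply_mem, fun _ => Submodule.starProjection_eq_self_iff.2⟩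
  · apply Φ.injective
    ext1 v
    rw [map_mul, hP]
    exact Submodule.starProjection_eq_self_iff.2 ⟨v, rfl⟩

theorem sq_norm_trace_le_rank_mul (X : Matrix n n 𝕜) :
    ‖X.trace‖ ^ 2 ≤ X.rank * RCLike.re (Xᴴ * X).trace := by
  obtain ⟨P, ⟨hPP, hP⟩, htrace, hPX⟩ := exists_isStarProjection_mul_eq_self X
  have hP : Pᴴ = P := hP
  calc ‖X.trace‖ ^ 2 = ‖(Pᴴ * X).trace‖ ^ 2 := by rw [hP, hPX]
    _ ≤ RCLike.re (Pᴴ * P).trace * RCLike.re (Xᴴ * X).trace :=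
      sq_norm_trace_conjTranspose_mul_le P X
    _ = X.rank * RCLike.re (Xᴴ * X).trace := by rw [hP, hPP.eq, htrace, RCLike.natCast_re]

theorem rank_vecMulVec_kronecker_le {R l p : Type*} [CommRing R] [StrongRankCondition R]
    [Fintype p] (u : m → R) (v : n → R) (B : Matrix l p R) :
    (Matrix.vecMulVec u v ⊗ₖ B).rank ≤ Fintype.card p := by
  classical
  rw [Matrix.vecMulVec_eq Unit, ← Matrix.mul_one B, Matrix.mul_kronecker_mul]
  refine (Matrix.rank_mul_le_left _ _).trans ((Matrix.rank_le_card_width _).trans_eq ?_)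
  simp

end RankAndTrace

section PureOperators

variable {m n m' n' : Type*}

/-- The rank one operator `|x⟩⟨x|` of the vector `x` in `ℂ^m ⊗ ℂ^n` whose coefficient at `|i⟩|j⟩` is
`X j i`, so that the rank of `X` is the Schmidt rank of `x`. -/
def pureOp (X : Matrix n m ℂ) : Matrix (m × n) (m × n) ℂ :=
  Matrix.vecMulVec X.vec (star X.vec)

theorem posSemidef_pureOp [Finite m] [Finite n] (X : Matrix n m ℂ) : (pureOp X).PosSemidef :=
  Matrix.posSemidef_vecMulVec_self_star _

variable [Fintype m] [Fintype n]

theorem trace_pureOp (X : Matrix n m ℂ) : (pureOp X).trace = (Xᴴ * X).trace := by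
  rw [pureOp, Matrix.trace_vecMulVec, dotProduct_comm, Matrix.star_vec_dotProduct_vec]

theorem kronecker_mul_pureOp_mul_conjTranspose
    (A : Matrix m' m ℂ) (B : Matrix n' n ℂ) (X : Matrix n m ℂ) :
    (A ⊗ₖ B) * pureOp X * (A ⊗ₖ B)ᴴ = pureOp (B * X * Aᵀ) := by
  rw [pureOp, Matrix.mul_vecMulVec, Matrix.vecMulVec_mul, ← Matrix.star_mulVec,
    Matrix.kronecker_mulVec_vec, pureOp]

end PureOperators

section KrausMaps

variable {m n κ ι : Type*} [Fintype n] [Fintype κ]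

/-- The completely positive map with Kraus operators `A k`. -/
def krausMap (A : κ → Matrix m n ℂ) : Matrix n n ℂ →ₗ[ℝ] Matrix m m ℂ where
  toFun ρ := ∑ k, A k * ρ * (A k)ᴴ
  map_add' ρ σ := by simp only [Matrix.mul_add, Matrix.add_mul, Finset.sum_add_distrib]
  map_smul' c ρ := by
    simp only [Matrix.mul_smul, Matrix.smul_mul, Finset.smul_sum, RingHom.id_apply]

theorem krausMap_apply (A : κ → Matrix m n ℂ) (ρ : Matrix n n ℂ) :
    krausMap A ρ = ∑ k, A k * ρ * (A k)ᴴ := rfl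

theorem posSemidef_krausMap [Finite m] (A : κ → Matrix m n ℂ) {ρ : Matrix n n ℂ}
    (hρ : ρ.PosSemidef) : (krausMap A ρ).PosSemidef :=
  Matrix.posSemidef_sum _ fun k _ => hρ.mul_mul_conjTranspose_same (A k)

theorem sum_trace_krausMap [Fintype m] [Fintype ι] [DecidableEq n] {A : ι → κ → Matrix m n ℂ}
    (hA : ∑ i, ∑ k, (A i k)ᴴ * A i k = 1) (ρ : Matrix n n ℂ) :
    ∑ i, (krausMap (A i) ρ).trace = ρ.trace := by
  have trace_conj (i : ι) (k : κ) :
      (A i k * ρ * (A i k)ᴴ).trace = ((A i k)ᴴ * A i k * ρ).trace := by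
    rw [Matrix.trace_mul_comm, Matrix.mul_assoc]
  simp only [krausMap_apply, Matrix.trace_sum, trace_conj]
  simp only [← Matrix.trace_sum, ← Matrix.sum_mul, hA, Matrix.one_mul]

end KrausMaps

section Fidelity

variable {T : ℕ}

theorem maxEnt_eq_vec (T : ℕ) :
    maxEnt T = (((1 / √T : ℝ) : ℂ) • (1 : Matrix (Fin T) (Fin T) ℂ)).vec := by
  ext p
  simp [maxEnt, Matrix.vec, Matrix.one_apply, eq_comm]

theorem maxEntState_eq_pureOp (T : ℕ) :
    maxEntState T = pureOp (((1 / √T : ℝ) : ℂ) • (1 : Matrix (Fin T) (Fin T) ℂ)) := by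
  rw [maxEntState, maxEnt_eq_vec, pureOp]

theorem posSemidef_maxEntState (T : ℕ) : (maxEntState T).PosSemidef :=
  Matrix.posSemidef_vecMulVec_self_star _

theorem maxEntState_apply (p q : Fin T × Fin T) :
    maxEntState T p q = if p.1 = p.2 ∧ q.1 = q.2 then ((1 / T : ℝ) : ℂ) else 0 := by
  have hT : ((1 / T : ℝ) : ℂ) = ((1 / √T : ℝ) : ℂ) * ((1 / √T : ℝ) : ℂ) := by
    rw [← Complex.ofReal_mul, div_mul_div_comm, one_mul, Real.mul_self_sqrt (Nat.cast_nonneg T)]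
  simp only [maxEntState, Matrix.vecMulVec_apply, maxEnt, Pi.star_apply, hT, ite_and]
  split_ifs <;> simp

theorem trace_maxEntState (hT : T ≠ 0) : (maxEntState T).trace = 1 := by
  have : (T : ℂ) ≠ 0 := Nat.cast_ne_zero.2 hT
  simp [Matrix.trace, Fintype.sum_prod_type, maxEntState_apply, this]

theorem fidelity_eq_re_trace_mul (ρ : BiOp T T) : fidelity ρ = (maxEntState T * ρ).trace.re := by
  rw [fidelity, maxEntState, Matrix.trace_mul_comm, Matrix.mul_vecMulVec, Matrix.trace_vecMulVec,
    dotProduct_comm]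

theorem fidelity_eq_sum (ρ : BiOp T T) :
    fidelity ρ = 1 / T * ∑ i, ∑ j, (ρ (i, i) (j, j)).re := by
  have : ((maxEntState T * ρ).trace) = ((1 / T : ℝ) : ℂ) * ∑ j, ∑ i, ρ (i, i) (j, j) := by
    simp only [Matrix.trace, Matrix.diag_apply, Matrix.mul_apply, maxEntState_apply, ite_and,
      Fintype.sum_prod_type, ite_mul, zero_mul, Finset.sum_ite_eq, Finset.mem_univ, if_true,
      Finset.mul_sum, Finset.sum_ite_irrel, Finset.sum_const_zero]
  rw [fidelity_eq_re_trace_mul, this, Complex.re_ofReal_mul, Finset.sum_comm]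
  simp only [Complex.re_sum]

theorem fidelity_pureOp (X : Matrix (Fin T) (Fin T) ℂ) :
    fidelity (pureOp X) = 1 / T * ‖X.trace‖ ^ 2 := by
  rw [fidelity_eq_sum, ← Complex.normSq_eq_norm_sq, ← Complex.ofReal_re (Complex.normSq _),
    ← Complex.mul_conj]
  simp [pureOp, Matrix.vecMulVec_apply, Matrix.vec, Matrix.trace, Finset.sum_mul_sum]

theorem fidelity_maxEntState (hT : T ≠ 0) : fidelity (maxEntState T) = 1 := by
  have : (T : ℝ) ≠ 0 := Nat.cast_ne_zero.2 hT
  have hsqrt : (1 / √T) ^ 2 = 1 / (T : ℝ) := by rw [div_pow, one_pow, Real.sq_sqrt T.cast_nonneg]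
  rw [maxEntState_eq_pureOp, fidelity_pureOp, Matrix.trace_smul, Matrix.trace_one, norm_smul,
    mul_pow, Complex.norm_real, Real.norm_eq_abs, sq_abs, hsqrt, Fintype.card_fin,
    Complex.norm_natCast]
  field_simp

theorem fidelity_nonneg {ρ : BiOp T T} (hρ : ρ.PosSemidef) : 0 ≤ fidelity ρ :=
  (Complex.le_def.1 (hρ.dotProduct_mulVec_nonneg (maxEnt T))).1

/-- The fidelity as a linear functional. -/
noncomputable def fidelityLinear (T : ℕ) : BiOp T T →ₗ[ℝ] ℝ where
  toFun := fidelity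
  map_add' ρ σ := by simp [fidelity, Matrix.add_mulVec]
  map_smul' c ρ := by simp [fidelity, Matrix.smul_mulVec]

theorem fidelity_smul (c : ℝ) (ρ : BiOp T T) : fidelity (c • ρ) = c * fidelity ρ :=
  map_smul (fidelityLinear T) c ρ

end Fidelity

section LocalOperations

variable {a a' b b' m M r : ℕ}

namespace Instrument

theorem onAlice_eq_krausMap (E : Instrument a a' m) (i : Fin m) (ρ : BiOp a b) :
    E.onAlice i ρ = krausMap (fun k => E.kraus i k ⊗ₖ (1 : Matrix (Fin b) (Fin b) ℂ)) ρ := rfl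

theorem onBob_eq_krausMap (E : Instrument b b' m) (i : Fin m) (ρ : BiOp a b) :
    E.onBob i ρ = krausMap (fun k => (1 : Matrix (Fin a) (Fin a) ℂ) ⊗ₖ E.kraus i k) ρ := rfl

theorem posSemidef_onAlice (E : Instrument a a' m) (i : Fin m) {ρ : BiOp a b}
    (hρ : ρ.PosSemidef) : (E.onAlice i ρ).PosSemidef :=
  posSemidef_krausMap _ hρ

theorem posSemidef_onBob (E : Instrument b b' m) (i : Fin m) {ρ : BiOp a b}
    (hρ : ρ.PosSemidef) : (E.onBob i ρ).PosSemidef :=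
  posSemidef_krausMap _ hρ

theorem sum_trace_onAlice (E : Instrument a a' m) (ρ : BiOp a b) :
    ∑ i, (E.onAlice i ρ).trace = ρ.trace := by
  refine sum_trace_krausMap
    (A := fun i k => E.kraus i k ⊗ₖ (1 : Matrix (Fin b) (Fin b) ℂ)) ?_ ρ
  simp only [Matrix.conjTranspose_kronecker, ← Matrix.mul_kronecker_mul, Matrix.conjTranspose_one,
    Matrix.one_mul]
  rw [← Matrix.one_kronecker_one, ← E.complete]
  ext
  simp [Matrix.sum_apply, Finset.sum_mul]

theorem sum_trace_onBob (E : Instrument b b' m) (ρ : BiOp a b) :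
    ∑ i, (E.onBob i ρ).trace = ρ.trace := by
  refine sum_trace_krausMap
    (A := fun i k => (1 : Matrix (Fin a) (Fin a) ℂ) ⊗ₖ E.kraus i k) ?_ ρ
  simp only [Matrix.conjTranspose_kronecker, ← Matrix.mul_kronecker_mul, Matrix.conjTranspose_one,
    Matrix.one_mul]
  rw [← Matrix.one_kronecker_one, ← E.complete]
  ext
  simp [Matrix.sum_apply, Finset.mul_sum]

theorem onAlice_pureOp (E : Instrument a a' m) (i : Fin m) (X : Matrix (Fin b) (Fin a) ℂ) :
    E.onAlice i (pureOp X) = ∑ k, pureOp (X * (E.kraus i k)ᵀ) := by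
  simp only [onAlice, kronecker_mul_pureOp_mul_conjTranspose, Matrix.one_mul]

theorem onBob_pureOp (E : Instrument b b' m) (i : Fin m) (X : Matrix (Fin b) (Fin a) ℂ) :
    E.onBob i (pureOp X) = ∑ k, pureOp (E.kraus i k * X) := by
  simp only [onBob, kronecker_mul_pureOp_mul_conjTranspose, Matrix.transpose_one, Matrix.mul_one]

end Instrument

namespace LOCC

theorem posSemidef_branch (j : Fin r) (P : LOCC M r a b) {ρ : BiOp a b}
    (hρ : ρ.PosSemidef) : (P.branch j ρ).PosSemidef := by
  induction P with
  | fail => exact Matrix.PosSemidef.zero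
  | output j' =>
    rw [branch]
    split_ifs
    exacts [hρ, Matrix.PosSemidef.zero]
  | alice _ _ E _ ih =>
    exact Matrix.posSemidef_sum _ fun i _ => ih i (E.posSemidef_onAlice i hρ)
  | bob _ _ E _ ih => exact Matrix.posSemidef_sum _ fun i _ => ih i (E.posSemidef_onBob i hρ)

theorem failProb_add_sum_outProb (P : LOCC M r a b) (ρ : BiOp a b) :
    P.failProb ρ + ∑ j, P.outProb ρ j = ρ.trace.re := by
  induction P with
  | fail => simp [failProb, outProb, branch]
  | output j => simp [failProb, outProb, branch, apply_ite]
  | alice _ m E next ih =>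
    rw [← E.sum_trace_onAlice ρ, Complex.re_sum, ← Finset.sum_congr rfl fun i _ => ih i _,
      Finset.sum_add_distrib, Finset.sum_comm (γ := Fin m)]
    simp only [failProb, outProb, branch, Matrix.trace_sum, Complex.re_sum]
  | bob _ m E next ih =>
    rw [← E.sum_trace_onBob ρ, Complex.re_sum, ← Finset.sum_congr rfl fun i _ => ih i _,
      Finset.sum_add_distrib, Finset.sum_comm (γ := Fin m)]
    simp only [failProb, outProb, branch, Matrix.trace_sum, Complex.re_sum]

/-- The sum of the fidelities of all unnormalised outputs, a linear functional of the input. For a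
protocol that never fails it is the fidelity of the output when no classical information is kept. -/
noncomputable def expectedFidelity : {a b : ℕ} → LOCC M r a b → BiOp a b →ₗ[ℝ] ℝ
  | _, _, fail _ _ => 0
  | _, _, output _ => fidelityLinear M
  | _, _, alice _ _ E next => ∑ i, (next i).expectedFidelity ∘ₗ krausMap fun k => E.kraus i k ⊗ₖ 1
  | _, _, bob _ _ E next => ∑ i, (next i).expectedFidelity ∘ₗ krausMap fun k => 1 ⊗ₖ E.kraus i k

theorem expectedFidelity_fail (ρ : BiOp a b) :
    (fail a b : LOCC M r a b).expectedFidelity ρ = 0 := rfl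

theorem expectedFidelity_output (j : Fin r) (ρ : BiOp M M) :
    (output j).expectedFidelity ρ = fidelity ρ := rfl

theorem expectedFidelity_alice (E : Instrument a a' m) (next : Fin m → LOCC M r a' b)
    (ρ : BiOp a b) : (alice a' m E next).expectedFidelity ρ =
      ∑ i, (next i).expectedFidelity (E.onAlice i ρ) := by
  simp only [expectedFidelity, LinearMap.sum_apply, LinearMap.comp_apply,
    ← Instrument.onAlice_eq_krausMap]

theorem expectedFidelity_bob (E : Instrument b b' m) (next : Fin m → LOCC M r a b')
    (ρ : BiOp a b) : (bob b' m E next).expectedFidelity ρ =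
      ∑ i, (next i).expectedFidelity (E.onBob i ρ) := by
  simp only [expectedFidelity, LinearMap.sum_apply, LinearMap.comp_apply,
    ← Instrument.onBob_eq_krausMap]

theorem expectedFidelity_eq_sum (P : LOCC M r a b) (ρ : BiOp a b) :
    P.expectedFidelity ρ = ∑ j, fidelity (P.branch j ρ) := by
  have fidelity_zero : fidelity (0 : BiOp M M) = 0 := map_zero (fidelityLinear M)
  have fidelity_sum {m : ℕ} (σ : Fin m → BiOp M M) : fidelity (∑ i, σ i) = ∑ i, fidelity (σ i) :=
    map_sum (fidelityLinear M) σ Finset.univ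
  induction P with
  | fail => simp [expectedFidelity_fail, branch, fidelity_zero]
  | output j => simp [expectedFidelity_output, branch, apply_ite fidelity, fidelity_zero]
  | alice _ _ E next ih =>
    simp only [expectedFidelity_alice, ih, branch, fidelity_sum]
    exact Finset.sum_comm
  | bob _ _ E next ih =>
    simp only [expectedFidelity_bob, ih, branch, fidelity_sum]
    exact Finset.sum_comm

theorem expectedFidelity_pureOp_le (P : LOCC M r a b) (X : Matrix (Fin b) (Fin a) ℂ) :
    P.expectedFidelity (pureOp X) ≤ (min X.rank M : ℕ) / M * (pureOp X).trace.re := by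
  have trace_nonneg {a b : ℕ} (Y : Matrix (Fin b) (Fin a) ℂ) : 0 ≤ (pureOp Y).trace.re :=
    (Complex.le_def.1 (posSemidef_pureOp Y).trace_nonneg).1
  induction P with
  | fail => exact mul_nonneg (by positivity) (trace_nonneg X)
  | output j =>
    rw [expectedFidelity_output, fidelity_pureOp, one_div_mul_eq_div, div_mul_eq_mul_div,
      min_eq_left X.rank_le_width, trace_pureOp]
    gcongr
    exact sq_norm_trace_le_rank_mul X
  | alice _ _ E next ih =>
    simp only [expectedFidelity_alice, ← E.sum_trace_onAlice, E.onAlice_pureOp, map_sum,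
      Matrix.trace_sum, Complex.re_sum, Finset.mul_sum]
    gcongr with i _ k _
    refine (ih i _).trans ?_
    gcongr
    exacts [trace_nonneg _, Matrix.rank_mul_le_left _ _]
  | bob _ _ E next ih =>
    simp only [expectedFidelity_bob, ← E.sum_trace_onBob, E.onBob_pureOp, map_sum,
      Matrix.trace_sum, Complex.re_sum, Finset.mul_sum]
    gcongr with i _ k _
    refine (ih i _).trans ?_
    gcongr
    exacts [trace_nonneg _, Matrix.rank_mul_le_right _ _]

end LOCC

end LocalOperations

section AuxiliaryState

variable {a a' b b' d d' K : ℕ}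

/-- The regrouping of `(ℂ^a ⊗ ℂ^K) ⊗ (ℂ^b ⊗ ℂ^K)` into `(ℂ^a ⊗ ℂ^b) ⊗ (ℂ^K ⊗ ℂ^K)`. -/
def regroup (a b K : ℕ) : Fin (a * K) × Fin (b * K) ≃ (Fin a × Fin b) × (Fin K × Fin K) :=
  (Equiv.prodCongr finProdFinEquiv.symm finProdFinEquiv.symm).trans
    (Equiv.prodProdProdComm _ _ _ _)

/-- The map `ρ ↦ ρ ⊗ |Ψ_K⟩⟨Ψ_K|`, for local dimensions that may differ. -/
noncomputable def tensorAux (K : ℕ) : BiOp a b →ₗ[ℝ] BiOp (a * K) (b * K) where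
  toFun ρ := (ρ ⊗ₖ maxEntState K).submatrix (regroup a b K) (regroup a b K)
  map_add' ρ σ := by rw [Matrix.add_kronecker, Matrix.submatrix_add]; rfl
  map_smul' c ρ := by rw [Matrix.smul_kronecker, Matrix.submatrix_smul]; rfl

theorem tensorAux_eq_submatrix (ρ : BiOp a b) :
    tensorAux K ρ = (ρ ⊗ₖ maxEntState K).submatrix (regroup a b K) (regroup a b K) := rfl

theorem withAux_eq_tensorAux (ρ : BiOp a a) : withAux K ρ = tensorAux K ρ := rfl

theorem posSemidef_tensorAux {ρ : BiOp a b} (hρ : ρ.PosSemidef) : (tensorAux K ρ).PosSemidef :=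
  (hρ.kronecker (posSemidef_maxEntState K)).submatrix _

theorem trace_tensorAux (hK : K ≠ 0) (ρ : BiOp a b) : (tensorAux K ρ).trace = ρ.trace :=
  calc (tensorAux K ρ).trace = (ρ ⊗ₖ maxEntState K).trace :=
      (regroup a b K).sum_comp fun p => (ρ ⊗ₖ maxEntState K) p p
    _ = ρ.trace := by rw [Matrix.trace_kronecker, trace_maxEntState hK, mul_one]

theorem fidelity_tensorAux (hK : K ≠ 0) (ρ : BiOp a a) :
    fidelity (tensorAux K ρ) = fidelity ρ := by
  have entry (x y : Fin a) (k l : Fin K) :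
      (tensorAux K ρ (finProdFinEquiv (x, k), finProdFinEquiv (x, k))
        (finProdFinEquiv (y, l), finProdFinEquiv (y, l))).re = (ρ (x, x) (y, y)).re * (1 / K) := by
    simp only [tensorAux_eq_submatrix, Matrix.submatrix_apply, regroup, Equiv.trans_apply,
      Equiv.prodCongr_apply, Prod.map, Equiv.symm_apply_apply, Equiv.prodProdProdComm_apply,
      Matrix.kroneckerMap_apply, maxEntState_apply, and_self, if_true, Complex.re_mul_ofReal]
  have : (K : ℝ) ≠ 0 := Nat.cast_ne_zero.2 hK
  simp only [fidelity_eq_sum, ← finProdFinEquiv.sum_comp, Fintype.sum_prod_type, entry,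
    Finset.sum_const, Finset.card_univ, Fintype.card_fin, nsmul_eq_mul, ← Finset.mul_sum,
    ← Finset.sum_mul]
  push_cast
  field_simp

/-- The operator `A ⊗ 1` on `ℂ^d ⊗ ℂ^K = ℂ^(d * K)`. -/
def tensorOne (K : ℕ) (A : Matrix (Fin d') (Fin d) ℂ) : Matrix (Fin (d' * K)) (Fin (d * K)) ℂ :=
  (A ⊗ₖ (1 : Matrix (Fin K) (Fin K) ℂ)).submatrix finProdFinEquiv.symm finProdFinEquiv.symm

theorem tensorOne_one : tensorOne K (1 : Matrix (Fin d) (Fin d) ℂ) = 1 := by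
  rw [tensorOne, Matrix.one_kronecker_one, Matrix.submatrix_one_equiv]

theorem conjTranspose_tensorOne_mul_self (A : Matrix (Fin d') (Fin d) ℂ) :
    (tensorOne K A)ᴴ * tensorOne K A = tensorOne K (Aᴴ * A) := by
  rw [tensorOne, Matrix.conjTranspose_submatrix, Matrix.submatrix_mul_equiv,
    Matrix.conjTranspose_kronecker, ← Matrix.mul_kronecker_mul, Matrix.conjTranspose_one,
    Matrix.one_mul, tensorOne]

theorem tensorOne_sum {ι : Type*} (s : Finset ι) (A : ι → Matrix (Fin d') (Fin d) ℂ) :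
    tensorOne K (∑ i ∈ s, A i) = ∑ i ∈ s, tensorOne K (A i) := by
  ext
  simp [tensorOne, Matrix.sum_apply, Finset.sum_mul]

theorem tensorOne_kronecker_tensorOne (A : Matrix (Fin a') (Fin a) ℂ)
    (B : Matrix (Fin b') (Fin b) ℂ) :
    tensorOne K A ⊗ₖ tensorOne K B =
      ((A ⊗ₖ B) ⊗ₖ (1 : Matrix (Fin K × Fin K) (Fin K × Fin K) ℂ)).submatrix
        (regroup a' b' K) (regroup a b K) := by
  rw [← Matrix.one_kronecker_one]
  ext
  exact mul_mul_mul_comm _ _ _ _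

theorem tensorAux_mul_mul_conjTranspose (A : Matrix (Fin a') (Fin a) ℂ)
    (B : Matrix (Fin b') (Fin b) ℂ) (ρ : BiOp a b) :
    tensorAux K ((A ⊗ₖ B) * ρ * (A ⊗ₖ B)ᴴ) =
      (tensorOne K A ⊗ₖ tensorOne K B) * tensorAux K ρ * (tensorOne K A ⊗ₖ tensorOne K B)ᴴ := by
  simp only [tensorOne_kronecker_tensorOne, tensorAux_eq_submatrix, Matrix.conjTranspose_submatrix,
    Matrix.submatrix_mul_equiv, Matrix.conjTranspose_kronecker _ (1 : Matrix _ _ ℂ),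
    ← Matrix.mul_kronecker_mul, Matrix.conjTranspose_one, Matrix.one_mul, Matrix.mul_one]

theorem tensorAux_pureOp (X : Matrix (Fin b) (Fin a) ℂ) :
    tensorAux K (pureOp X) = pureOp (tensorOne K (((1 / √K : ℝ) : ℂ) • X)) := by
  ext p q
  simp only [tensorAux_eq_submatrix, maxEntState_eq_pureOp, pureOp, tensorOne, regroup,
    Matrix.submatrix_apply, Matrix.kroneckerMap_apply, Matrix.vecMulVec_apply, Matrix.vec,
    Matrix.smul_apply, Pi.star_apply, smul_eq_mul, star_mul', Equiv.trans_apply,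
    Equiv.prodCongr_apply, Prod.map, Equiv.prodProdProdComm_apply]
  ring

theorem rank_tensorOne_vecMulVec_le (u : Fin d' → ℂ) (v : Fin d → ℂ) :
    (tensorOne K (Matrix.vecMulVec u v)).rank ≤ K := by
  rw [tensorOne, Matrix.rank_submatrix]
  exact (rank_vecMulVec_kronecker_le u v _).trans_eq (Fintype.card_fin K)

end AuxiliaryState

section LowerBound

variable {N K M r : ℕ}

theorem LOCC.expectedFidelity_withAux_maxEntState_le (hN : N ≠ 0) (hK : K ≠ 0)
    (P : LOCC M r (N * K) (N * K)) : P.expectedFidelity (withAux K (maxEntState N)) ≤ 1 := by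
  rw [withAux_eq_tensorAux, maxEntState_eq_pureOp, tensorAux_pureOp]
  refine (P.expectedFidelity_pureOp_le _).trans ?_
  rw [← tensorAux_pureOp, ← maxEntState_eq_pureOp, trace_tensorAux hK, trace_maxEntState hN,
    Complex.one_re, mul_one]
  exact div_le_one_of_le₀ (Nat.cast_le.2 (min_le_right _ _)) (Nat.cast_nonneg M)

theorem LOCC.expectedFidelity_withAux_product_le (hK : K ≠ 0) (P : LOCC M r (N * K) (N * K))
    (u v : Fin N → ℂ) : P.expectedFidelity (withAux K (pureOp (Matrix.vecMulVec u v))) ≤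
      K / M * (pureOp (Matrix.vecMulVec u v)).trace.re := by
  rw [withAux_eq_tensorAux, ← trace_tensorAux hK, tensorAux_pureOp, ← Matrix.smul_vecMulVec]
  refine (P.expectedFidelity_pureOp_le _).trans ?_
  gcongr
  · exact (Complex.le_def.1 (posSemidef_pureOp _).trace_nonneg).1
  · exact (min_le_left _ _).trans (rank_tensorOne_vecMulVec_le _ v)

theorem trace_pureOp_single (x : Fin N) : (pureOp (Matrix.single x x 1)).trace = 1 := by
  simp [trace_pureOp, Matrix.conjTranspose_single]

/-- The mixture of `Ψ_N` and the product state `|x⟩|x⟩` with weights `1 - t` and `t`; it is the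
worst case input for the fidelity it has. -/
noncomputable def noisyState (x : Fin N) (t : ℝ) : BiOp N N :=
  (1 - t) • maxEntState N + t • pureOp (Matrix.single x x 1)

theorem isState_noisyState (x : Fin N) {t : ℝ} (ht : 0 ≤ t) (ht' : t ≤ 1) :
    IsState (noisyState x t) := by
  refine ⟨((posSemidef_maxEntState N).smul (sub_nonneg.2 ht')).add
    ((posSemidef_pureOp _).smul ht), ?_⟩
  rw [noisyState, Matrix.trace_add, Matrix.trace_smul, Matrix.trace_smul,
    trace_maxEntState x.pos.ne', trace_pureOp_single, ← add_smul, sub_add_cancel, one_smul]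

theorem fidelity_noisyState (x : Fin N) (t : ℝ) :
    fidelity (noisyState x t) = 1 - t * (1 - 1 / N) := by
  have fidelity_single : fidelity (pureOp (Matrix.single x x 1)) = 1 / N := by
    rw [fidelity_pureOp, Matrix.trace_single_eq_same, norm_one, one_pow, mul_one]
  have fidelity_add (ρ σ : BiOp N N) : fidelity (ρ + σ) = fidelity ρ + fidelity σ :=
    map_add (fidelityLinear N) ρ σ
  rw [noisyState, fidelity_add, fidelity_smul, fidelity_smul, fidelity_maxEntState x.pos.ne',
    fidelity_single]
  ring

theorem LOCC.expectedFidelity_withAux_noisyState_le (hK : K ≠ 0) (P : LOCC M r (N * K) (N * K))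
    (x : Fin N) {t : ℝ} (ht : 0 ≤ t) (ht' : t ≤ 1) :
    P.expectedFidelity (withAux K (noisyState x t)) ≤ 1 - t * (1 - K / M) := by
  have le_maxEntState := P.expectedFidelity_withAux_maxEntState_le x.pos.ne' hK
  have le_product := P.expectedFidelity_withAux_product_le hK (Pi.single x 1) (Pi.single x 1)
  rw [← Matrix.single_eq_single_vecMulVec_single, trace_pureOp_single, Complex.one_re, mul_one]
    at le_product
  calc P.expectedFidelity (withAux K (noisyState x t))
      = (1 - t) * P.expectedFidelity (withAux K (maxEntState N)) +
          t * P.expectedFidelity (withAux K (pureOp (Matrix.single x x 1))) := by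
        simp only [withAux_eq_tensorAux, noisyState, map_add, map_smul, smul_eq_mul]
    _ ≤ (1 - t) * 1 + t * (K / M) := by
        gcongr
    _ = 1 - t * (1 - K / M) := by ring

namespace GEPP.AbsolutelySuccessful

variable {P : GEPP N K M} {ε δ : ℝ}

theorem one_sub_le_expectedFidelity (hP : P.AbsolutelySuccessful ε δ) {ρ : BiOp N N}
    (hρ : IsState ρ) (hF : 1 - ε ≤ fidelity ρ) :
    1 - δ ≤ P.locc.expectedFidelity (withAux K ρ) := by
  have posSemidef_branch (j) : (P.locc.branch j (withAux K ρ)).PosSemidef :=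
    P.locc.posSemidef_branch j (posSemidef_tensorAux hρ.1)
  have one_sub_eq : 1 - δ = (1 - δ) * P.probFidelityGE ρ (1 - δ) := by
    rw [(hP ρ hρ hF).2, mul_one]
  rw [one_sub_eq, probFidelityGE, Finset.mul_sum, LOCC.expectedFidelity_eq_sum]
  refine Finset.sum_le_sum fun j _ => ?_
  have fidelity_branch_nonneg := fidelity_nonneg (posSemidef_branch j)
  have outProb_nonneg : 0 ≤ P.locc.outProb (withAux K ρ) j :=
    (Complex.le_def.1 (posSemidef_branch j).trace_nonneg).1
  split_ifs with h
  · refine (mul_le_mul_of_nonneg_right h outProb_nonneg).trans ?_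
    rw [LOCC.outState, fidelity_smul]
    rcases eq_or_ne (P.locc.outProb (withAux K ρ) j) 0 with h0 | h0
    · rwa [h0, mul_zero]
    · rw [mul_comm, mul_inv_cancel_left₀ h0]
  · rwa [mul_zero]

theorem le_delta (hP : P.AbsolutelySuccessful ε δ) (hN : 2 ≤ N) (hK : K ≠ 0) (hM : M ≠ 0)
    (hε : 0 ≤ ε) (hε' : ε ≤ 1 - 1 / (N : ℝ)) :
    ((M : ℝ) - K) / M * ((N : ℝ) / ((N : ℝ) - 1)) * ε ≤ δ := by
  have hN0 : (0 : ℝ) < N := by positivity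
  have hN1 : (0 : ℝ) < (N : ℝ) - 1 := sub_pos.2 (Nat.one_lt_cast.2 hN)
  have hM0 : (M : ℝ) ≠ 0 := Nat.cast_ne_zero.2 hM
  let x : Fin N := ⟨0, by omega⟩
  let t : ℝ := N / (N - 1) * ε
  have ht : 0 ≤ t := by positivity
  have htε : t * (1 - 1 / N) = ε := by
    simp only [t]
    field_simp
  have ht' : t ≤ 1 := by
    refine le_of_mul_le_mul_right (a := 1 - 1 / (N : ℝ)) ?_ ?_
    · rwa [htε, one_mul]
    · rw [one_sub_div hN0.ne']
      positivity
  have fidelity_eq : fidelity (noisyState x t) = 1 - ε := by rw [fidelity_noisyState, htε]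
  have lower := hP.one_sub_le_expectedFidelity (isState_noisyState x ht ht') fidelity_eq.ge
  have upper := P.locc.expectedFidelity_withAux_noisyState_le hK x ht ht'
  calc ((M : ℝ) - K) / M * ((N : ℝ) / ((N : ℝ) - 1)) * ε = t * (1 - K / M) := by
        rw [sub_div, div_self hM0, mul_assoc, mul_comm]
    _ ≤ δ := by linarith

end GEPP.AbsolutelySuccessful

end LowerBound

section Lift

variable {a a' b b' d d' m r K L : ℕ}

namespace Instrument

/-- The instrument acting as `E` on the first factor of `ℂ^d ⊗ ℂ^K`. -/
def lift (K : ℕ) (E : Instrument d d' m) : Instrument (d * K) (d' * K) m where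
  numKraus := E.numKraus
  kraus i k := tensorOne K (E.kraus i k)
  complete := by
    simp only [conjTranspose_tensorOne_mul_self, ← tensorOne_sum, E.complete, tensorOne_one]

theorem onAlice_lift (E : Instrument a a' m) (i : Fin m) (ρ : BiOp a b) :
    (E.lift K).onAlice i (tensorAux K ρ) = tensorAux K (E.onAlice i ρ) := by
  simp only [onAlice, map_sum, tensorAux_mul_mul_conjTranspose, tensorOne_one]
  rfl

theorem onBob_lift (E : Instrument b b' m) (i : Fin m) (ρ : BiOp a b) :
    (E.lift K).onBob i (tensorAux K ρ) = tensorAux K (E.onBob i ρ) := by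
  simp only [onBob, map_sum, tensorAux_mul_mul_conjTranspose, tensorOne_one]
  rfl

end Instrument

namespace LOCC

/-- The protocol acting as `P` on the first factors and leaving the auxiliary state untouched. -/
def lift (K : ℕ) : {a b : ℕ} → LOCC L r a b → LOCC (L * K) r (a * K) (b * K)
  | _, _, fail a b => fail (a * K) (b * K)
  | _, _, output j => output j
  | _, _, alice a' m E next => alice (a' * K) m (E.lift K) fun i => (next i).lift K
  | _, _, bob b' m E next => bob (b' * K) m (E.lift K) fun i => (next i).lift K

theorem failProb_lift (hK : K ≠ 0) (P : LOCC L r a b) (ρ : BiOp a b) :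
    (P.lift K).failProb (tensorAux K ρ) = P.failProb ρ := by
  induction P with
  | fail => simp only [lift, failProb, trace_tensorAux hK]
  | output => rfl
  | alice _ _ E next ih => simp only [lift, failProb, Instrument.onAlice_lift, ih]
  | bob _ _ E next ih => simp only [lift, failProb, Instrument.onBob_lift, ih]

theorem expectedFidelity_lift (hK : K ≠ 0) (P : LOCC L r a b) (ρ : BiOp a b) :
    (P.lift K).expectedFidelity (tensorAux K ρ) = P.expectedFidelity ρ := by
  induction P with
  | fail => rfl
  | output => simp only [lift, expectedFidelity_output, fidelity_tensorAux hK]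
  | alice _ _ E next ih => simp only [lift, expectedFidelity_alice, Instrument.onAlice_lift, ih]
  | bob _ _ E next ih => simp only [lift, expectedFidelity_bob, Instrument.onBob_lift, ih]

end LOCC

end Lift

section Randomization

variable {a b d n M r : ℕ} {ι : Type*} [Fintype ι] [Nonempty ι]

/-- A uniformly random outcome, independent of the state, which is left unchanged. -/
noncomputable def Instrument.uniform (d n : ℕ) [NeZero n] : Instrument d d n where
  numKraus := 1
  kraus _ _ := ((1 / √n : ℝ) : ℂ) • 1
  complete := by
    have : (n : ℂ) ≠ 0 := NeZero.ne _
    have sqrt_mul : ((√n : ℝ) : ℂ) * (√n : ℝ) = n := by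
      rw [← Complex.ofReal_mul, Real.mul_self_sqrt n.cast_nonneg, Complex.ofReal_natCast]
    ext
    simp [smul_smul, ← mul_inv, sqrt_mul, this]

theorem Instrument.onAlice_uniform [NeZero n] (i : Fin n) (ρ : BiOp a b) :
    (uniform a n).onAlice i ρ = (n : ℝ)⁻¹ • ρ := by
  have sq_inv_sqrt : ((1 / √n : ℝ) : ℂ) * (1 / √n : ℝ) = ((n : ℝ)⁻¹ : ℝ) := by
    rw [← Complex.ofReal_mul, div_mul_div_comm, one_mul, Real.mul_self_sqrt n.cast_nonneg, one_div]
  refine (Fin.sum_univ_one _).trans ?_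
  simp only [uniform, Matrix.smul_kronecker, Matrix.one_kronecker_one, Matrix.conjTranspose_smul,
    Matrix.conjTranspose_one, Matrix.smul_mul, Matrix.one_mul, Matrix.mul_smul, Matrix.mul_one,
    smul_smul, Complex.star_def, Complex.conj_ofReal, sq_inv_sqrt]
  rfl

namespace LOCC

/-- The protocol `next i` for an `i` that is drawn uniformly at random by Alice. -/
noncomputable def randomize (next : ι → LOCC M r a b) : LOCC M r a b :=
  alice a _ (Instrument.uniform a (Fintype.card ι)) fun i => next ((Fintype.equivFin ι).symm i)

theorem failProb_randomize {next : ι → LOCC M r a b} (h : ∀ i σ, (next i).failProb σ = 0)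
    (ρ : BiOp a b) : (randomize next).failProb ρ = 0 := by
  simp only [randomize, failProb, h, Finset.sum_const_zero]

theorem expectedFidelity_randomize (next : ι → LOCC M r a b) (ρ : BiOp a b) :
    (randomize next).expectedFidelity ρ = 𝔼 i, (next i).expectedFidelity ρ := by
  simp only [randomize, expectedFidelity_alice, Instrument.onAlice_uniform, map_smul, smul_eq_mul,
    ← Finset.mul_sum, (Fintype.equivFin ι).symm.sum_comp fun i => (next i).expectedFidelity ρ,
    Fintype.expect_eq_sum_div_card, div_eq_inv_mul]

end LOCC

end Randomization

section ProductPreparation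

variable {a b d d' M : ℕ}

namespace Instrument

/-- The channel that discards the state and prepares `|x⟩`. -/
def prepare (d : ℕ) (x : Fin d') : Instrument d d' 1 where
  numKraus := d
  kraus _ y := Matrix.single x y 1
  complete := by
    ext
    simp [Matrix.sum_apply, Matrix.conjTranspose_single, Matrix.single_apply, Matrix.one_apply,
      ite_and]

theorem onAlice_prepare_apply (x : Fin d') (ρ : BiOp a b) (p q : Fin d' × Fin b) :
    (prepare a x).onAlice 0 ρ p q =
      if x = q.1 ∧ x = p.1 then ∑ y, ρ (y, p.2) (y, q.2) else 0 := by
  refine (Matrix.sum_apply _ _ (Finset.univ : Finset (Fin a)) _).trans ?_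
  simp [prepare, Matrix.mul_apply, Fintype.sum_prod_type,
    Matrix.one_apply, Matrix.single_apply, ite_and, apply_ite (starRingEnd ℂ)]

theorem onBob_prepare_apply (x : Fin d') (ρ : BiOp a b) (p q : Fin a × Fin d') :
    (prepare b x).onBob 0 ρ p q =
      if x = q.2 ∧ x = p.2 then ∑ y, ρ (p.1, y) (q.1, y) else 0 := by
  refine (Matrix.sum_apply _ _ (Finset.univ : Finset (Fin b)) _).trans ?_
  simp [prepare, Matrix.mul_apply, Fintype.sum_prod_type,
    Matrix.one_apply, Matrix.single_apply, ite_and, apply_ite (starRingEnd ℂ)]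

end Instrument

namespace LOCC

/-- Alice and Bob replace their state by the product state `|x⟩|x⟩`. -/
def prepareProduct (a b : ℕ) (x : Fin M) : LOCC M 1 a b :=
  alice M 1 (Instrument.prepare a x) fun _ => bob M 1 (Instrument.prepare b x) fun _ => output 0

theorem failProb_prepareProduct (x : Fin M) (ρ : BiOp a b) :
    (prepareProduct a b x).failProb ρ = 0 := by
  simp only [prepareProduct, failProb, Finset.sum_const_zero]

theorem expectedFidelity_prepareProduct (x : Fin M) (ρ : BiOp a b) :
    (prepareProduct a b x).expectedFidelity ρ = 1 / M * ρ.trace.re := by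
  simp only [prepareProduct, expectedFidelity_alice, expectedFidelity_bob, expectedFidelity_output,
    Fin.sum_univ_one, fidelity_eq_sum, Instrument.onBob_prepare_apply,
    Instrument.onAlice_prepare_apply]
  simp [Matrix.trace, Fintype.sum_prod_type_right, ite_and, apply_ite Complex.re]

end LOCC

end ProductPreparation

section RandomPartition

open Finset in
theorem expect_same_part {α κ β : Type*} [Fintype α] [DecidableEq α] [Fintype κ] [DecidableEq κ]
    [Fintype β] [DecidableEq β] [Nonempty (α ≃ κ × β)] {x y : α} (hxy : x ≠ y) :
    (𝔼 e : α ≃ κ × β, if (e x).1 = (e y).1 then (1 : ℝ) else 0) =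
      ((Fintype.card β : ℝ) - 1) / ((Fintype.card α : ℝ) - 1) := by
  let same (z : α) (e : α ≃ κ × β) : ℝ := if (e x).1 = (e z).1 then 1 else 0
  have expect_same_eq (z : α) (hz : z ∈ univ.erase x) : 𝔼 e, same z e = 𝔼 e, same y e := by
    refine Fintype.expect_equiv ((Equiv.swap y z).equivCongr (Equiv.refl _)) _ _ fun e => ?_
    simp [same, Equiv.swap_apply_of_ne_of_ne hxy (ne_of_mem_erase hz).symm]
  have expect_same_self : 𝔼 e, same x e = 1 := by
    simp only [same, if_true, Fintype.expect_const]
  have sum_same (e : α ≃ κ × β) : ∑ z, same z e = Fintype.card β := by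
    simp only [same]
    rw [e.sum_comp fun p => if (e x).1 = p.1 then (1 : ℝ) else 0, Fintype.sum_prod_type_right]
    simp
  have double_count : (Fintype.card β : ℝ) = 1 + ((Fintype.card α : ℝ) - 1) * 𝔼 e, same y e :=
    calc (Fintype.card β : ℝ) = 𝔼 e, ∑ z, same z e := by simp only [sum_same, Fintype.expect_const]
      _ = ∑ z, 𝔼 e, same z e := expect_sum_comm ..
      _ = 1 + ∑ z ∈ univ.erase x, 𝔼 e, same y e := by
        rw [← add_sum_erase _ _ (mem_univ x), expect_same_self, sum_congr rfl expect_same_eq]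
      _ = 1 + ((Fintype.card α : ℝ) - 1) * 𝔼 e, same y e := by
        rw [sum_const, card_erase_of_mem (mem_univ x), card_univ, nsmul_eq_mul,
          Nat.cast_sub (Fintype.card_pos_iff.2 ⟨x⟩), Nat.cast_one]
  have card_ne : (Fintype.card α : ℝ) - 1 ≠ 0 :=
    sub_ne_zero.2 (Nat.cast_ne_one.2 (Fintype.one_lt_card_iff.2 ⟨x, y, hxy⟩).ne')
  rw [eq_div_iff card_ne]
  linarith

theorem expect_sum_ite_same_part {α κ β : Type*} [Fintype α] [DecidableEq α] [Fintype κ]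
    [DecidableEq κ] [Fintype β] [DecidableEq β] [Nonempty (α ≃ κ × β)] (g h : α → α → ℝ)
    (hgh : ∀ x, g x x = h x x) :
    (𝔼 e : α ≃ κ × β, ∑ x, ∑ y, if (e x).1 = (e y).1 then g x y else h x y) =
      ∑ x, ∑ y, (h x y +
        ((Fintype.card β : ℝ) - 1) / ((Fintype.card α : ℝ) - 1) * (g x y - h x y)) := by
  simp only [Finset.expect_sum_comm]
  refine Finset.sum_congr rfl fun x _ => Finset.sum_congr rfl fun y _ => ?_
  rcases eq_or_ne x y with rfl | hxy
  · simp only [hgh, ite_self, Fintype.expect_const, sub_self, mul_zero, add_zero]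
  · have ite_eq (e : α ≃ κ × β) : (if (e x).1 = (e y).1 then g x y else h x y) =
        h x y + (if (e x).1 = (e y).1 then (1 : ℝ) else 0) * (g x y - h x y) := by
      split_ifs <;> ring
    simp only [ite_eq, Finset.expect_add_distrib, Fintype.expect_const, ← Finset.expect_mul,
      expect_same_part hxy]

end RandomPartition

section PartitionProtocol

variable {a b N Q L : ℕ}

namespace Instrument

/-- The projective measurement of the part `q`, for the partition of the basis vectors of `ℂ^N` into
the parts `{x | (e x).1 = q}`; the part that is found is identified with the basis of `ℂ^L`. -/
noncomputable def measurePart (e : Fin N ≃ Fin Q × Fin L) : Instrument N L Q where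
  numKraus := 1
  kraus q _ := Matrix.of fun l x => if (q, l) = e x then 1 else 0
  complete := by
    ext x y
    have sum_projections :
        ∑ p : Fin Q × Fin L, (if p = e y ∧ p = e x then 1 else 0) = (1 : Matrix _ _ ℂ) x y := by
      simp [Matrix.one_apply, ite_and, eq_comm]
    rw [← sum_projections, Fintype.sum_prod_type]
    simp [Matrix.sum_apply, Matrix.mul_apply, ite_and, apply_ite (starRingEnd ℂ)]

theorem onAlice_measurePart_apply (e : Fin N ≃ Fin Q × Fin L) (q : Fin Q) (ρ : BiOp N b)
    (l l' : Fin L) (y y' : Fin b) :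
    (measurePart e).onAlice q ρ (l, y) (l', y') = ρ (e.symm (q, l), y) (e.symm (q, l'), y') := by
  refine (congrFun₂ (Fin.sum_univ_one _) _ _).trans ?_
  simp [measurePart, Matrix.mul_apply, Fintype.sum_prod_type, Matrix.one_apply,
    apply_ite (starRingEnd ℂ), ← Equiv.symm_apply_eq]

theorem onBob_measurePart_apply (e : Fin N ≃ Fin Q × Fin L) (q : Fin Q) (ρ : BiOp a N)
    (x x' : Fin a) (l l' : Fin L) :
    (measurePart e).onBob q ρ (x, l) (x', l') = ρ (x, e.symm (q, l)) (x', e.symm (q, l')) := by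
  refine (congrFun₂ (Fin.sum_univ_one _) _ _).trans ?_
  simp [measurePart, Matrix.mul_apply, Fintype.sum_prod_type, Matrix.one_apply,
    apply_ite (starRingEnd ℂ), ← Equiv.symm_apply_eq]

end Instrument

namespace LOCC

/-- Alice and Bob measure in which part of the partition `e` they are, and replace their state by
the product state `|l₀⟩|l₀⟩` if the results differ. -/
noncomputable def partitionProtocol (l₀ : Fin L) (e : Fin N ≃ Fin Q × Fin L) : LOCC L 1 N N :=
  alice L Q (Instrument.measurePart e) fun q => bob L Q (Instrument.measurePart e) fun q' =>
    if q = q' then output 0 else prepareProduct L L l₀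

theorem failProb_partitionProtocol (l₀ : Fin L) (e : Fin N ≃ Fin Q × Fin L) (ρ : BiOp N N) :
    (partitionProtocol l₀ e).failProb ρ = 0 := by
  refine Finset.sum_eq_zero fun q _ => Finset.sum_eq_zero fun q' _ => ?_
  dsimp only
  split_ifs
  exacts [rfl, failProb_prepareProduct l₀ _]

theorem expectedFidelity_partitionProtocol (l₀ : Fin L) (e : Fin N ≃ Fin Q × Fin L)
    (ρ : BiOp N N) :
    (partitionProtocol l₀ e).expectedFidelity ρ = 1 / L * ∑ x, ∑ y,
      if (e x).1 = (e y).1 then (ρ (x, x) (y, y)).re else (ρ (x, y) (x, y)).re := by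
  have output_eq (q q' : Fin Q) :
      (if q = q' then output 0 else prepareProduct L L l₀ : LOCC L 1 L L).expectedFidelity
        ((Instrument.measurePart e).onBob q' ((Instrument.measurePart e).onAlice q ρ)) =
      1 / L * ∑ l, ∑ l', if q = q'
        then (ρ (e.symm (q, l), e.symm (q, l)) (e.symm (q', l'), e.symm (q', l'))).re
        else (ρ (e.symm (q, l), e.symm (q', l')) (e.symm (q, l), e.symm (q', l'))).re := by
    split_ifs with h
    · simp only [← h, expectedFidelity_output, fidelity_eq_sum,
        Instrument.onBob_measurePart_apply, Instrument.onAlice_measurePart_apply]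
    · simp only [expectedFidelity_prepareProduct, Matrix.trace, Matrix.diag_apply,
        Fintype.sum_prod_type, Complex.re_sum,
        Instrument.onBob_measurePart_apply, Instrument.onAlice_measurePart_apply]
  simp only [partitionProtocol, expectedFidelity_alice, expectedFidelity_bob, output_eq,
    ← Finset.mul_sum, ← e.symm.sum_comp, Fintype.sum_prod_type, Equiv.apply_symm_apply]
  congr 1
  exact Finset.sum_congr rfl fun q _ => Finset.sum_comm

/-- The partition protocol for a random partition into parts of size `L`. -/
noncomputable def randomPartitionProtocol [Nonempty (Fin N ≃ Fin Q × Fin L)] (l₀ : Fin L) :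
    LOCC L 1 N N :=
  randomize (partitionProtocol l₀ (N := N) (Q := Q))

variable [Nonempty (Fin N ≃ Fin Q × Fin L)]

theorem failProb_randomPartitionProtocol (l₀ : Fin L) (ρ : BiOp N N) :
    (randomPartitionProtocol (Q := Q) l₀).failProb ρ = 0 :=
  failProb_randomize (failProb_partitionProtocol l₀) ρ

theorem expectedFidelity_randomPartitionProtocol (hN : N ≠ 0) (l₀ : Fin L) (ρ : BiOp N N) :
    (randomPartitionProtocol (Q := Q) l₀).expectedFidelity ρ =
      1 / L * (ρ.trace.re + (L - 1) / (N - 1) * (N * fidelity ρ - ρ.trace.re)) := by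
  have trace_eq : ρ.trace.re = ∑ x, ∑ y, (ρ (x, y) (x, y)).re := by
    simp only [Matrix.trace, Matrix.diag_apply, Fintype.sum_prod_type, Complex.re_sum]
  have fidelity_eq : N * fidelity ρ = ∑ x, ∑ y, (ρ (x, x) (y, y)).re := by
    rw [fidelity_eq_sum, ← mul_assoc, mul_one_div_cancel (Nat.cast_ne_zero.2 hN), one_mul]
  simp only [randomPartitionProtocol, expectedFidelity_randomize,
    expectedFidelity_partitionProtocol, ← Finset.mul_expect]
  rw [expect_sum_ite_same_part (fun x y => (ρ (x, x) (y, y)).re) (fun x y => (ρ (x, y) (x, y)).re)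
    fun _ => rfl, trace_eq, fidelity_eq]
  simp only [Finset.sum_add_distrib, ← Finset.mul_sum, Finset.sum_sub_distrib, Fintype.card_fin]

end LOCC

end PartitionProtocol

section Tightness

variable {N K M : ℕ}

theorem GEPP.absolutelySuccessful_of_expectedFidelity (hK : K ≠ 0) {P : LOCC M 1 (N * K) (N * K)}
    {ε δ : ℝ} (hfail : ∀ ρ, P.failProb (withAux K ρ) = 0)
    (hfid : ∀ ρ, IsState ρ → 1 - ε ≤ fidelity ρ → 1 - δ ≤ P.expectedFidelity (withAux K ρ)) :
    (⟨1, P⟩ : GEPP N K M).AbsolutelySuccessful ε δ := by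
  intro ρ hρ hF
  have outProb_eq_one : P.outProb (withAux K ρ) 0 = 1 := by
    have total := P.failProb_add_sum_outProb (withAux K ρ)
    rwa [hfail ρ, zero_add, Fin.sum_univ_one, withAux_eq_tensorAux, trace_tensorAux hK, hρ.2,
      Complex.one_re] at total
  have outState_eq : P.outState (withAux K ρ) 0 = P.branch 0 (withAux K ρ) := by
    rw [LOCC.outState, outProb_eq_one, inv_one, one_smul]
  have le_fidelity := hfid ρ hρ hF
  rw [P.expectedFidelity_eq_sum, Fin.sum_univ_one, ← outState_eq] at le_fidelity
  refine ⟨hfail ρ, ?_⟩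
  rw [probFidelityGE, Fin.sum_univ_one, if_pos le_fidelity, outProb_eq_one]

theorem LOCC.one_sub_le_expectedFidelity_randomPartitionProtocol {L Q : ℕ}
    [Nonempty (Fin N ≃ Fin Q × Fin L)] (hN : 2 ≤ N) (l₀ : Fin L) {ε : ℝ} {ρ : BiOp N N}
    (hρ : IsState ρ) (hF : 1 - ε ≤ fidelity ρ) :
    1 - ((L : ℝ) - 1) / L * ((N : ℝ) / ((N : ℝ) - 1)) * ε ≤
      (randomPartitionProtocol (Q := Q) l₀).expectedFidelity ρ := by
  have hN1 : (0 : ℝ) < (N : ℝ) - 1 := sub_pos.2 (Nat.one_lt_cast.2 hN)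
  have hL : (0 : ℝ) < L := Nat.cast_pos.2 l₀.pos
  have hL1 : (0 : ℝ) ≤ (L : ℝ) - 1 := sub_nonneg.2 (Nat.one_le_cast.2 l₀.pos)
  have infidelity_le : 1 - fidelity ρ ≤ ε := by linarith
  rw [expectedFidelity_randomPartitionProtocol (by omega), hρ.2, Complex.one_re]
  calc 1 - ((L : ℝ) - 1) / L * ((N : ℝ) / ((N : ℝ) - 1)) * ε
      ≤ 1 - ((L : ℝ) - 1) / L * ((N : ℝ) / ((N : ℝ) - 1)) * (1 - fidelity ρ) := by gcongr
    _ = 1 / L * (1 + (L - 1) / (N - 1) * (N * fidelity ρ - 1)) := by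
      field_simp
      ring

theorem exists_absolutelySuccessful (hN : 2 ≤ N) (hK : K ≠ 0) (hMN : M ∣ N * K) (hKM : K ∣ M) :
    ∃ P : GEPP N K M, ∀ ε : ℝ,
      P.AbsolutelySuccessful ε (((M : ℝ) - K) / M * ((N : ℝ) / ((N : ℝ) - 1)) * ε) := by
  obtain ⟨L, rfl⟩ := hKM
  rw [mul_comm K L] at hMN ⊢
  obtain ⟨Q, rfl⟩ := Nat.dvd_of_mul_dvd_mul_right (Nat.pos_of_ne_zero hK) hMN
  have : Nonempty (Fin (L * Q) ≃ Fin Q × Fin L) :=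
    ⟨finProdFinEquiv.symm.trans (Equiv.prodComm _ _)⟩
  let l₀ : Fin L := ⟨0, Nat.pos_of_mul_pos_right (zero_lt_two.trans_le hN)⟩
  refine ⟨⟨1, (LOCC.randomPartitionProtocol (Q := Q) l₀).lift K⟩, fun ε =>
    GEPP.absolutelySuccessful_of_expectedFidelity hK (fun ρ => ?_) fun ρ hρ hF => ?_⟩
  · rw [withAux_eq_tensorAux, LOCC.failProb_lift hK, LOCC.failProb_randomPartitionProtocol]
  · have ratio_eq : (((L * K : ℕ) : ℝ) - K) / (L * K : ℕ) = ((L : ℝ) - 1) / L := by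
      rw [Nat.cast_mul, ← sub_one_mul, mul_div_mul_right _ _ (Nat.cast_ne_zero.2 hK)]
    rw [withAux_eq_tensorAux, LOCC.expectedFidelity_lift hK, ratio_eq]
    exact LOCC.one_sub_le_expectedFidelity_randomPartitionProtocol hN l₀ hρ hF

end Tightness

end Purification

theorem theorem1 (N K M : ℕ) (hN : 2 ≤ N) (hK : 1 ≤ K) (hM : 1 ≤ M) :
    (∀ ε δ : ℝ, 0 ≤ ε → ε ≤ 1 - 1 / (N : ℝ) →
      ∀ P : Purification.GEPP N K M, P.AbsolutelySuccessful ε δ →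
        ((M : ℝ) - K) / M * ((N : ℝ) / ((N : ℝ) - 1)) * ε ≤ δ) ∧
    (M ∣ N * K → K ∣ M →
      ∃ P : Purification.GEPP N K M, ∀ ε : ℝ, 0 ≤ ε →
        P.AbsolutelySuccessful ε
          (((M : ℝ) - K) / M * ((N : ℝ) / ((N : ℝ) - 1)) * ε)) :=
  ⟨fun _ _ hε hε' _ hP => hP.le_delta hN (by omega) (by omega) hε hε', fun hMN hKM =>
    have ⟨P, hP⟩ := Purification.exists_absolutelySuccessful hN (by omega) hMN hKM
    ⟨P, fun ε _ => hP ε⟩⟩
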